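/- Let $(M,g)$ be a smooth Riemannian manifold and let $(N,h)$ and $(P,k)$ be Kähler manifolds, all finite-dimensional and without boundary, with $P$ non-empty and of positive dimension. A smooth map $\phi$ from a Riemannian manifold $(M,g)$ to a Hermitian manifold $(N,J,h)$ is called a pseudo harmonic morphism if it is harmonic, i.e. its tension field $\tau(\phi)=\operatorname{tr}_g\nabla d\phi$ vanishes, and pseudo horizontally weakly conformal, i.e. $[d\phi_x\circ (d\phi_x)^{*},J]=0$ on $T_{\phi(x)}N$ for every $x\in M$, where $(d\phi_x)^{*}$ is the adjoint of $d\phi_x$ with respect to $g$ and $h$. Let $\phi:M\to N$ be a smooth map. Then $\phi$ is a pseudo harmonic morphism if and only if, for every open set $U\subseteq N$ and every map $\psi:U\to P$ that is holomorphic or antiholomorphic, the composition $\psi\circ\phi:\phi^{-1}(U)\to P$ is a pseudo harmonic morphism on the open subset $\phi^{-1}(U)$ of $(M,g)$. -/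

import Mathlib

open scoped Manifold ContDiff
open Bundle Module

noncomputable section

namespace PseudoHarmonic

/-! ### Linear algebra relative to a positive definite symmetric form -/

section LinearAlgebra

variable {V : Type*} [AddCommGroup V] [Module ℝ V] [TopologicalSpace V] [FiniteDimensional ℝ V]
  {W : Type*} [AddCommGroup W] [Module ℝ W]

/-- The matrix `g_{ij}` of a bilinear form in the basis `b = Module.finBasis ℝ V`. -/
def gram (G : V →L[ℝ] V →L[ℝ] ℝ) : Matrix (Fin (finrank ℝ V)) (Fin (finrank ℝ V)) ℝ :=
  Matrix.of fun i j => G (finBasis ℝ V i) (finBasis ℝ V j)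

/-- The trace `∑ g^{ij} B(b_i, b_j)` with respect to `G` of a bilinear `B : V × V → W`. -/
def traceWith (G : V →L[ℝ] V →L[ℝ] ℝ) (B : V → V → W) : W :=
  ∑ i, ∑ j, (gram G)⁻¹ i j • B (finBasis ℝ V i) (finBasis ℝ V j)

/-- The vector `∑ g^{ij} α(b_j) b_i` which represents the linear form `α` with respect to `G`. -/
def sharp (G : V →L[ℝ] V →L[ℝ] ℝ) (α : V → ℝ) : V :=
  ∑ i, ∑ j, ((gram G)⁻¹ i j * α (finBasis ℝ V j)) • finBasis ℝ V i

variable [TopologicalSpace W]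

/-- The adjoint `A* : W → V` of `A : V → W` with respect to the forms `G` on `V` and `H` on `W`. -/
def adjointWith (G : V →L[ℝ] V →L[ℝ] ℝ) (H : W →L[ℝ] W →L[ℝ] ℝ) (A : V →L[ℝ] W) (w : W) : V :=
  sharp G (fun v => H w (A v))

theorem isUnit_det_gram (G : V →L[ℝ] V →L[ℝ] ℝ) (hpos : ∀ v, v ≠ 0 → 0 < G v v) :
    IsUnit (gram G).det := by
  rw [isUnit_iff_ne_zero]
  intro h0
  obtain ⟨c, hc, hz⟩ := Matrix.exists_mulVec_eq_zero_iff.2 h0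
  have hne : (∑ i, c i • finBasis ℝ V i) ≠ 0 := by
    intro hs
    exact hc (funext (Fintype.linearIndependent_iff.1 (finBasis ℝ V).linearIndependent c hs))
  refine (hpos _ hne).ne' ?_
  have key : G (∑ i, c i • finBasis ℝ V i) (∑ i, c i • finBasis ℝ V i)
      = ∑ i, c i * (gram G).mulVec c i := by
    simp only [map_sum, map_smul, sum_apply, smul_apply,
      smul_eq_mul, Matrix.mulVec, dotProduct, gram, Matrix.of_apply, Finset.mul_sum]
    rw [Finset.sum_comm]
    refine Finset.sum_congr rfl fun i _ => Finset.sum_congr rfl fun j _ => ?_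
    ring
  rw [key, hz]
  simp

/-- `sharp G α` is the vector representing `α`. -/
theorem sharp_spec (G : V →L[ℝ] V →L[ℝ] ℝ) (hsymm : ∀ v w, G v w = G w v)
    (hpos : ∀ v, v ≠ 0 → 0 < G v v) (α : V →ₗ[ℝ] ℝ) (v : V) : G (sharp G α) v = α v := by
  have hu := isUnit_det_gram G hpos
  have hlin : (G (sharp G α) : V →ₗ[ℝ] ℝ) = α := by
    refine (finBasis ℝ V).ext fun k => ?_
    have h1 : gram G * (gram G)⁻¹ = 1 := Matrix.mul_nonsing_inv _ hu
    have h2 : ∀ j, ∑ i, gram G k i * (gram G)⁻¹ i j = if k = j then 1 else 0 := fun j => by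
      rw [← Matrix.mul_apply, h1, Matrix.one_apply]
    calc G (sharp G α) (finBasis ℝ V k)
        = ∑ j, (∑ i, gram G k i * (gram G)⁻¹ i j) * α (finBasis ℝ V j) := by
          simp only [sharp, map_sum, map_smul, sum_apply,
            smul_apply, smul_eq_mul, Finset.sum_mul]
          rw [Finset.sum_comm]
          refine Finset.sum_congr rfl fun j _ => Finset.sum_congr rfl fun i _ => ?_
          rw [hsymm (finBasis ℝ V i)]
          simp only [gram, Matrix.of_apply]
          ring
      _ = α (finBasis ℝ V k) := by simp [h2]
  exact LinearMap.congr_fun hlin v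

/-- `adjointWith G H A` is the adjoint of `A`. -/
theorem adjointWith_spec (G : V →L[ℝ] V →L[ℝ] ℝ) (H : W →L[ℝ] W →L[ℝ] ℝ) (A : V →L[ℝ] W)
    (hsymm : ∀ v w, G v w = G w v) (hpos : ∀ v, v ≠ 0 → 0 < G v v) (w : W) (v : V) :
    G (adjointWith G H A w) v = H w (A v) :=
  sharp_spec G hsymm hpos ((H w : W →ₗ[ℝ] ℝ) ∘ₗ (A : V →ₗ[ℝ] W)) v

end LinearAlgebra

/-! ### Riemannian metrics in charts and harmonic maps -/

section Riemannian

/-- Smooth Riemannian metrics on a manifold modelled on the real normed space `E`. -/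
abbrev Metric (E : Type*) [NormedAddCommGroup E] [NormedSpace ℝ E]
    (M : Type*) [TopologicalSpace M] [ChartedSpace E M] [IsManifold 𝓘(ℝ, E) ∞ M] :=
  ContMDiffRiemannianMetric 𝓘(ℝ, E) ∞ E (fun x : M => TangentSpace 𝓘(ℝ, E) x)

instance {E : Type*} [NormedAddCommGroup E] [NormedSpace ℝ E] [FiniteDimensional ℝ E]
    {M : Type*} [TopologicalSpace M] [ChartedSpace E M] (x : M) :
    FiniteDimensional ℝ (TangentSpace 𝓘(ℝ, E) x) :=
  inferInstanceAs (FiniteDimensional ℝ E)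

variable {E : Type*} [NormedAddCommGroup E] [NormedSpace ℝ E]
  {M : Type*} [TopologicalSpace M] [ChartedSpace E M] [IsManifold 𝓘(ℝ, E) ∞ M]
  {E' : Type*} [NormedAddCommGroup E'] [NormedSpace ℝ E']
  {N : Type*} [TopologicalSpace N] [ChartedSpace E' N] [IsManifold 𝓘(ℝ, E') ∞ N]

/-- The metric `g` written in the preferred chart at `x`, as a function of the coordinate `u`:
the pull-back of `g` under the inverse of the chart. -/
def chartMetric (g : Metric E M) (x : M) (u : E) : E →L[ℝ] E →L[ℝ] ℝ :=
  let p : M := (extChartAt 𝓘(ℝ, E) x).symm u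
  let A : E →L[ℝ] E := mfderiv 𝓘(ℝ, E) 𝓘(ℝ, E) (extChartAt 𝓘(ℝ, E) x).symm u
  let G : E →L[ℝ] E →L[ℝ] ℝ := g.inner p
  G.bilinearComp A A

/-- The directional derivative `D_v (B(w, z))` at the point `u` of a field `B` of bilinear forms. -/
def directional (B : E → E →L[ℝ] E →L[ℝ] ℝ) (u v w z : E) : ℝ :=
  fderiv ℝ (fun t => B t w z) u v

/-- The Christoffel symbols `Γ(v, w) = ∇_v w` (for constant fields `v`, `w`) at the point `u` of the
Levi-Civita connection of a metric `G` on an open subset of `E`, determined by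
`2 G(Γ(v, w), z) = D_v G(w, z) + D_w G(v, z) - D_z G(v, w)`. -/
def christoffel [FiniteDimensional ℝ E] (G : E → E →L[ℝ] E →L[ℝ] ℝ) (u v w : E) : E :=
  sharp (G u) fun z => (1 / 2 : ℝ) *
    (directional G u v w z + directional G u w v z - directional G u z v w)

/-- The second fundamental form `(∇dφ)_x(v, w)`, written in the preferred charts at `x` and `φ x`:
`D²φ(v, w) - Dφ(Γ^M(v, w)) + Γ^N(Dφ v, Dφ w)`. -/
def secondFundamentalForm [FiniteDimensional ℝ E] [FiniteDimensional ℝ E']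
    (g : Metric E M) (h : Metric E' N) (φ : M → N) (x : M) (v w : E) : E' :=
  let f : E → E' := writtenInExtChartAt 𝓘(ℝ, E) 𝓘(ℝ, E') x φ
  let u : E := extChartAt 𝓘(ℝ, E) x x
  fderiv ℝ (fderiv ℝ f) u v w - fderiv ℝ f u (christoffel (chartMetric g x) u v w)
    + christoffel (chartMetric h (φ x)) (f u) (fderiv ℝ f u v) (fderiv ℝ f u w)

/-- The tension field `τ(φ) = tr_g ∇dφ`, a section of `φ⁻¹ TN`. -/
def tensionField [FiniteDimensional ℝ E] [FiniteDimensional ℝ E']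
    (g : Metric E M) (h : Metric E' N) (φ : M → N) (x : M) : TangentSpace 𝓘(ℝ, E') (φ x) :=
  traceWith (W := E') (chartMetric g x (extChartAt 𝓘(ℝ, E) x x)) (secondFundamentalForm g h φ x)

/-- `φ` is a harmonic map on the open set `s`: it is smooth there and its tension field vanishes. -/
def IsHarmonicOn [FiniteDimensional ℝ E] [FiniteDimensional ℝ E']
    (g : Metric E M) (h : Metric E' N) (φ : M → N) (s : Set M) : Prop :=
  ContMDiffOn 𝓘(ℝ, E) 𝓘(ℝ, E') ∞ φ s ∧ ∀ x ∈ s, tensionField g h φ x = 0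

end Riemannian

/-! ### Complex manifolds, Kähler metrics, pseudo harmonic morphisms -/

section Complex

/-- A complex manifold is a real manifold. -/
instance isManifold_real {E : Type*} [NormedAddCommGroup E] [NormedSpace ℂ E]
    {N : Type*} [TopologicalSpace N] [ChartedSpace E N] {n : ℕ∞ω} [IsManifold 𝓘(ℂ, E) n N] :
    IsManifold 𝓘(ℝ, E) n N := by
  refine isManifold_of_contDiffOn 𝓘(ℝ, E) n N fun e e' he he' => ?_
  have h := (contDiffGroupoid n 𝓘(ℂ, E)).compatible he he'
  rw [contDiffGroupoid, mem_groupoid_of_pregroupoid] at h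
  exact ContDiffOn.restrict_scalars ℝ h.1

variable {E : Type*} [NormedAddCommGroup E] [NormedSpace ℂ E]
  {N : Type*} [TopologicalSpace N] [ChartedSpace E N]
  {E' : Type*} [NormedAddCommGroup E'] [NormedSpace ℂ E']
  {P : Type*} [TopologicalSpace P] [ChartedSpace E' P]

variable (E) in
/-- Multiplication by `i` as a real linear map. -/
def mulI : E →L[ℝ] E := Complex.I • ContinuousLinearMap.id ℝ E

/-- The complex structure `J` of a complex manifold, on the real tangent space at `y`. -/
def complexStructure (y : N) : TangentSpace 𝓘(ℝ, E) y →L[ℝ] TangentSpace 𝓘(ℝ, E) y :=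
  mulI E

/-- `ψ` is holomorphic on the open set `U`: smooth, with `dψ ∘ J = J ∘ dψ`. -/
def IsHolomorphicOn (ψ : N → P) (U : Set N) : Prop :=
  ContMDiffOn 𝓘(ℝ, E) 𝓘(ℝ, E') ∞ ψ U ∧
    ∀ y ∈ U, ∀ v : TangentSpace 𝓘(ℝ, E) y,
      mfderiv 𝓘(ℝ, E) 𝓘(ℝ, E') ψ y (complexStructure y v)
        = complexStructure (ψ y) (mfderiv 𝓘(ℝ, E) 𝓘(ℝ, E') ψ y v)

/-- `ψ` is antiholomorphic on the open set `U`: smooth, with `dψ ∘ J = -J ∘ dψ`. -/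
def IsAntiholomorphicOn (ψ : N → P) (U : Set N) : Prop :=
  ContMDiffOn 𝓘(ℝ, E) 𝓘(ℝ, E') ∞ ψ U ∧
    ∀ y ∈ U, ∀ v : TangentSpace 𝓘(ℝ, E) y,
      mfderiv 𝓘(ℝ, E) 𝓘(ℝ, E') ψ y (complexStructure y v)
        = -complexStructure (ψ y) (mfderiv 𝓘(ℝ, E) 𝓘(ℝ, E') ψ y v)

/-- The fundamental form `ω(v, w) = h(Jv, w)` written in the preferred (holomorphic) chart at
`y`, as a function of the coordinate. -/
def chartFundamentalForm [IsManifold 𝓘(ℝ, E) ∞ N] (h : Metric E N) (y : N) (u : E) :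
    E →L[ℝ] E →L[ℝ] ℝ :=
  (chartMetric h y u).comp (mulI E)

/-- A metric on a complex manifold is Kähler if it is Hermitian and its fundamental form is closed.
The exterior derivative of the fundamental form at `y` is computed in the preferred chart at `y`:
`dω(v, w, z) = D_v ω(w, z) + D_w ω(z, v) + D_z ω(v, w)`. -/
structure IsKahler [IsManifold 𝓘(ℂ, E) ω N] (h : Metric E N) : Prop where
  hermitian : ∀ (y : N) (v w : TangentSpace 𝓘(ℝ, E) y),
    h.inner y (complexStructure y v) (complexStructure y w) = h.inner y v w
  closed : ∀ (y : N) (v w z : E),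
    let D : E → E → E → ℝ :=
      directional (chartFundamentalForm h y) (extChartAt 𝓘(ℝ, E) y y)
    D v w z + D w z v + D z v w = 0

variable {F : Type*} [NormedAddCommGroup F] [NormedSpace ℝ F] [FiniteDimensional ℝ F]
  {M : Type*} [TopologicalSpace M] [ChartedSpace F M] [IsManifold 𝓘(ℝ, F) ∞ M]

/-- Pseudo horizontal weak conformality of `φ` on the open set `s`: `[dφ ∘ (dφ)*, J] = 0`. -/
def IsPHWCOn [IsManifold 𝓘(ℂ, E) ω N] (g : Metric F M) (h : Metric E N)
    (φ : M → N) (s : Set M) : Prop :=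
  ∀ x ∈ s, ∀ w : TangentSpace 𝓘(ℝ, E) (φ x),
    let dφ : TangentSpace 𝓘(ℝ, F) x →L[ℝ] TangentSpace 𝓘(ℝ, E) (φ x) :=
      mfderiv 𝓘(ℝ, F) 𝓘(ℝ, E) φ x
    let dφAdj : TangentSpace 𝓘(ℝ, E) (φ x) → TangentSpace 𝓘(ℝ, F) x :=
      adjointWith (g.inner x) (h.inner (φ x)) dφ
    dφ (dφAdj (complexStructure (φ x) w)) = complexStructure (φ x) (dφ (dφAdj w))

/-- `φ`, restricted to the open set `s`, is a pseudo harmonic morphism. -/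
def IsPseudoHarmonicMorphismOn [FiniteDimensional ℂ E] [IsManifold 𝓘(ℂ, E) ω N]
    (g : Metric F M) (h : Metric E N) (φ : M → N) (s : Set M) : Prop :=
  IsHarmonicOn g h φ s ∧ IsPHWCOn g h φ s

/-- `φ` is a pseudo harmonic morphism. -/
def IsPseudoHarmonicMorphism [FiniteDimensional ℂ E] [IsManifold 𝓘(ℂ, E) ω N]
    (g : Metric F M) (h : Metric E N) (φ : M → N) : Prop :=
  IsPseudoHarmonicMorphismOn g h φ Set.univ

end Complex

end PseudoHarmonic

end

/-! The theorem rests on the composition law τ(ψ∘φ) = dψ(τ(φ)) + tr_g ∇dψ(dφ, dφ), which is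
`modelTension_comp`. Everything is evaluated at the centres of the preferred charts, where the
derivative of the inverse chart is the identity, so coordinate expressions agree there with the
intrinsic ones.

Forward direction: for ψ holomorphic or antiholomorphic between Kähler manifolds, ∇dψ(Jv, Jw) =
-∇dψ(v, w) (`IsSignHolomorphicOn.secondFundamentalForm_mulI`). In holomorphic coordinates this holds
for D²ψ and, by closedness of the fundamental form, for the Christoffel symbols
(`IsKahler.christoffel_mulI`). If dφ dφ* commutes with J, the g-trace of the pull-back of such a
form vanishes (`traceWith_pullback_eq_zero`), so harmonicity passes to ψ∘φ. Conformality passes too,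
since dψ and dψ* both commute, or both anticommute, with J (`IsSignHolomorphicOn.phwc_comp`).

Converse: harmonicity of ψ∘φ for holomorphic ψ is enough. Let l be a complex linear form on the
model space of N and e ≠ 0 a vector in that of P. The map with coordinate expression l²e has zero
differential at the centre, so the law leaves tr_g (l∘dφ)² = 0. Polarising, and taking for one form
the complexification of h(a, ·), gives dφ dφ* J = J dφ dφ* (`chartDeriv_adjointDeriv_mulI`). With
conformality known, the trace term also vanishes for the map with expression le, leaving l(τ(φ))e =
0; as l is arbitrary, τ(φ) = 0 (`modelTension_eq_zero`). -/

noncomputable section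

namespace PseudoHarmonic

/-! ### Traces and adjoints relative to scalar products -/

section LinearAlgebra

variable {V : Type*} [AddCommGroup V] [Module ℝ V] [TopologicalSpace V]
  {W : Type*} [AddCommGroup W] [Module ℝ W]
  {X : Type*} [AddCommGroup X] [Module ℝ X]

/-- A definite form separates points. -/
theorem eq_of_forall_form_eq (G : V →L[ℝ] V →L[ℝ] ℝ) (hpos : ∀ v, v ≠ 0 → 0 < G v v) {a b : V}
    (hab : ∀ v, G a v = G b v) : a = b := by
  by_contra hne
  have h1 := hpos (a - b) (sub_ne_zero.2 hne)
  rw [map_sub G, sub_apply, hab, sub_self] at h1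
  exact lt_irrefl _ h1

variable [FiniteDimensional ℝ V]

/-- Expansion of a vector in the chosen basis by means of the inverse Gram matrix. -/
theorem sum_gram_inv_smul (G : V →L[ℝ] V →L[ℝ] ℝ) (hsymm : ∀ v w, G v w = G w v)
    (hpos : ∀ v, v ≠ 0 → 0 < G v v) (a : V) :
    ∑ i, ∑ j, ((gram G)⁻¹ i j * G a (finBasis ℝ V j)) • finBasis ℝ V i = a :=
  eq_of_forall_form_eq G hpos fun v => sharp_spec G hsymm hpos (G a : V →ₗ[ℝ] ℝ) v

theorem gram_inv_symm (G : V →L[ℝ] V →L[ℝ] ℝ) (hsymm : ∀ v w, G v w = G w v) (i j) :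
    (gram G)⁻¹ i j = (gram G)⁻¹ j i := by
  have h1 : (gram G).transpose = gram G := by
    ext i j
    exact hsymm _ _
  have h2 := Matrix.transpose_nonsing_inv (gram G)
  rw [h1] at h2
  exact congrFun (congrFun h2 j) i

theorem traceWith_swap (G : V →L[ℝ] V →L[ℝ] ℝ) (hsymm : ∀ v w, G v w = G w v) (B : V → V → W) :
    traceWith G (fun v w => B w v) = traceWith G B := by
  unfold traceWith
  rw [Finset.sum_comm]
  exact Finset.sum_congr rfl fun i _ => Finset.sum_congr rfl fun j _ => by
    rw [gram_inv_symm G hsymm]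

theorem traceWith_add (G : V →L[ℝ] V →L[ℝ] ℝ) (B C : V → V → W) :
    traceWith G (fun v w => B v w + C v w) = traceWith G B + traceWith G C := by
  simp only [traceWith, smul_add, Finset.sum_add_distrib]

theorem traceWith_neg (G : V →L[ℝ] V →L[ℝ] ℝ) (B : V → V → W) :
    traceWith G (fun v w => -B v w) = -traceWith G B := by
  simp only [traceWith, smul_neg, Finset.sum_neg_distrib]

theorem map_traceWith (G : V →L[ℝ] V →L[ℝ] ℝ) (L : W →ₗ[ℝ] X) (B : V → V → W) :
    L (traceWith G B) = traceWith G (fun v w => L (B v w)) := by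
  simp only [traceWith, map_sum, map_smul]

/-- Contraction against the form itself. -/
theorem traceWith_form_smul (G : V →L[ℝ] V →L[ℝ] ℝ) (hsymm : ∀ v w, G v w = G w v)
    (hpos : ∀ v, v ≠ 0 → 0 < G v v) (L : V →ₗ[ℝ] W) (a : V) :
    traceWith G (fun v w => G a w • L v) = L a := by
  conv_rhs => rw [← sum_gram_inv_smul G hsymm hpos a]
  simp only [traceWith, map_sum, map_smul, smul_smul]

variable [TopologicalSpace W] [FiniteDimensional ℝ W]

/-- The trace of the pull-back of `B` under `L` is the trace of `B (L L* ·, ·)`. -/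
theorem traceWith_pullback (G : V →L[ℝ] V →L[ℝ] ℝ) (hG : ∀ v w, G v w = G w v)
    (hGpos : ∀ v, v ≠ 0 → 0 < G v v) (H : W →L[ℝ] W →L[ℝ] ℝ) (hH : ∀ v w, H v w = H w v)
    (hHpos : ∀ v, v ≠ 0 → 0 < H v v) (L : V →ₗ[ℝ] W) (T : W → V)
    (hT : ∀ w v, G (T w) v = H w (L v)) (B : W →ₗ[ℝ] W →ₗ[ℝ] X) :
    traceWith G (fun v w => B (L v) (L w)) = traceWith H (fun v w => B (L (T w)) v) := by
  have key : ∀ v w, B (L v) (L w) =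
      ∑ k, ∑ l, (gram H)⁻¹ k l •
        (G (T (finBasis ℝ W l)) w • (B.flip (finBasis ℝ W k) ∘ₗ L) v) := by
    intro v w
    -- Expanding L w in the basis of W turns its coefficients into G(T b_l, w), so the G-trace
    -- becomes a contraction against G itself.
    conv_lhs => rw [← sum_gram_inv_smul H hH hHpos (L w)]
    simp only [map_sum, map_smul, hT, hH (L w), smul_smul, LinearMap.comp_apply,
      LinearMap.flip_apply]
  have h2 : ∀ l k, traceWith G (fun v w => G (T (finBasis ℝ W l)) w •
      (B.flip (finBasis ℝ W k) ∘ₗ L) v) = B (L (T (finBasis ℝ W l))) (finBasis ℝ W k) :=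
    fun l k => traceWith_form_smul G hG hGpos _ _
  calc traceWith G (fun v w => B (L v) (L w))
      = ∑ k, ∑ l, (gram H)⁻¹ k l • traceWith G (fun v w => G (T (finBasis ℝ W l)) w •
        (B.flip (finBasis ℝ W k) ∘ₗ L) v) := by
        simp only [key, traceWith, Finset.smul_sum]
        rw [Finset.sum_congr rfl fun i _ => Finset.sum_comm, Finset.sum_comm]
        refine Finset.sum_congr rfl fun k _ => ?_
        rw [Finset.sum_congr rfl fun i _ => Finset.sum_comm, Finset.sum_comm]
        refine Finset.sum_congr rfl fun l _ => Finset.sum_congr rfl fun i _ =>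
          Finset.sum_congr rfl fun j _ => ?_
        rw [smul_comm]
    _ = traceWith H (fun v w => B (L (T w)) v) := by simp only [h2]; rfl

/-- If `L L*` commutes with the isometric complex structure `J`, then the trace of the pull-back
under `L` of a bilinear map which is anti-invariant under `J` vanishes. -/
theorem traceWith_pullback_eq_zero (G : V →L[ℝ] V →L[ℝ] ℝ) (hG : ∀ v w, G v w = G w v)
    (hGpos : ∀ v, v ≠ 0 → 0 < G v v) (H : W →L[ℝ] W →L[ℝ] ℝ) (hH : ∀ v w, H v w = H w v)
    (hHpos : ∀ v, v ≠ 0 → 0 < H v v) (L : V →ₗ[ℝ] W) (T : W →ₗ[ℝ] V)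
    (hT : ∀ w v, G (T w) v = H w (L v)) (J : W →ₗ[ℝ] W) (hJ : ∀ w, J (J w) = -w)
    (hJH : ∀ v w, H (J v) (J w) = H v w) (hLT : ∀ w, L (T (J w)) = J (L (T w)))
    (B : W →ₗ[ℝ] W →ₗ[ℝ] X) (hB : ∀ v w, B (J v) (J w) = -B v w) :
    traceWith G (fun v w => B (L v) (L w)) = 0 := by
  have hJadj : ∀ w v, H (-J w) v = H w (J v) := fun w v => by
    have := hJH w (J v)
    rw [hJ] at this
    rw [← this]
    simp
  have h1 := traceWith_pullback G hG hGpos H hH hHpos L T hT B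
  -- Pulling back under the isometry J, whose adjoint is -J, leaves an H-trace unchanged. Since L T
  -- commutes with J, anti-invariance of B also reverses its sign, so the trace is its own negative.
  have h2 := traceWith_pullback H hH hHpos H hH hHpos J (fun w => -J w) hJadj (B ∘ₗ L ∘ₗ T)
  simp only [LinearMap.comp_apply, map_neg, hJ, neg_neg, hLT, hB] at h2
  rw [traceWith_neg] at h2
  have h3 : traceWith H (fun v w => B (L (T v)) w) = traceWith H (fun v w => B (L (T w)) v) :=
    traceWith_swap H hH fun v w => B (L (T w)) v
  rw [h1]
  rw [h3] at h2
  have h4 := add_eq_zero_iff_eq_neg.2 h2.symm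
  rw [← two_smul ℝ] at h4
  exact (smul_eq_zero.1 h4).resolve_left two_ne_zero

end LinearAlgebra

/-! ### The metric in charts -/

section Charts

open Filter Topology

variable {E : Type*} [NormedAddCommGroup E] [NormedSpace ℝ E]
  {M : Type*} [TopologicalSpace M] [ChartedSpace E M] [IsManifold 𝓘(ℝ, E) ∞ M]

/-- The metric at a point, as a bilinear form on the model space. -/
def innerModel (g : Metric E M) (p : M) : E →L[ℝ] E →L[ℝ] ℝ := g.inner p

/-- The derivative of the inverse of a chart, as a map of the model space. -/
def chartSymmDeriv (x : M) (u : E) : E →L[ℝ] E :=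
  mfderiv 𝓘(ℝ, E) 𝓘(ℝ, E) (extChartAt 𝓘(ℝ, E) x).symm u

theorem innerModel_symm (g : Metric E M) (p : M) (v w : E) :
    innerModel g p v w = innerModel g p w v :=
  g.symm p v w

theorem innerModel_pos (g : Metric E M) (p : M) (v : E) (hv : v ≠ 0) :
    0 < innerModel g p v v :=
  g.pos p v hv

theorem chartMetric_apply (g : Metric E M) (x : M) (u v w : E) :
    chartMetric g x u v w = innerModel g ((extChartAt 𝓘(ℝ, E) x).symm u)
      (chartSymmDeriv x u v) (chartSymmDeriv x u w) :=
  rfl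

theorem chartMetric_symm (g : Metric E M) (x : M) (u v w : E) :
    chartMetric g x u v w = chartMetric g x u w v := by
  rw [chartMetric_apply, chartMetric_apply, innerModel_symm]

theorem chartSymmDeriv_center (x : M) :
    chartSymmDeriv x (extChartAt 𝓘(ℝ, E) x x) = ContinuousLinearMap.id ℝ E := by
  have : IsManifold 𝓘(ℝ, E) 1 M := IsManifold.of_le (n := ∞) (by simp)
  have h := mfderivWithin_range_extChartAt_symm (I := 𝓘(ℝ, E)) (x := x)
  rw [modelWithCornersSelf_coe, Set.range_id, mfderivWithin_univ] at h
  exact h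

/-- At the centre of the chart the coordinate expression of the metric is the metric itself. -/
theorem chartMetric_center (g : Metric E M) (x : M) :
    chartMetric g x (extChartAt 𝓘(ℝ, E) x x) = innerModel g x := by
  ext v w
  rw [chartMetric_apply, chartSymmDeriv_center, extChartAt_to_inv]
  rfl

/-- The coefficients of the metric in a chart are differentiable. -/
theorem differentiableAt_chartMetric (g : Metric E M) (x : M) (w z : E) :
    DifferentiableAt ℝ (fun t => chartMetric g x t w z) (extChartAt 𝓘(ℝ, E) x x) := by
  have : IsManifold 𝓘(ℝ, E) 1 M := IsManifold.of_le (n := ∞) (by simp)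
  -- Smoothness of g as a bundle section means smoothness in the trivialization at x; it remains to
  -- see that the trivialization is inverted by the derivative of the inverse chart.
  have h1 := ((contMDiffAt_hom_bundle _).1 (g.contMDiff x)).2
  have h2 := h1.mdifferentiableAt (by simp)
  have h3 := (h2.comp_of_eq (extChartAt 𝓘(ℝ, E) x x)
    (mdifferentiableOn_extChartAt_symm.mdifferentiableAt
      ((isOpen_extChartAt_target x).mem_nhds (mem_extChartAt_target x)))
    (extChartAt_to_inv x)).differentiableAt
  have h4 := (h3.clm_apply (differentiableAt_const w)).clm_apply (differentiableAt_const z)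
  refine h4.congr_of_eventuallyEq ?_
  filter_upwards [(isOpen_extChartAt_target x).mem_nhds (mem_extChartAt_target x)] with t ht
  have hsrc : (extChartAt 𝓘(ℝ, E) x).symm t ∈ (chartAt E x).source := by
    rw [← extChartAt_source 𝓘(ℝ, E)]
    exact (extChartAt 𝓘(ℝ, E) x).map_target ht
  have hA : (trivializationAt E (TangentSpace 𝓘(ℝ, E)) x).symmL ℝ
      ((extChartAt 𝓘(ℝ, E) x).symm t) = chartSymmDeriv x t := by
    rw [TangentBundle.symmL_trivializationAt hsrc, modelWithCornersSelf_coe, Set.range_id,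
      mfderivWithin_univ, (extChartAt 𝓘(ℝ, E) x).right_inv ht]
    rfl
  have hA' : ∀ v : E, (trivializationAt E (TangentSpace 𝓘(ℝ, E)) x).symm
      ((extChartAt 𝓘(ℝ, E) x).symm t) v = chartSymmDeriv x t v := fun v =>
    (Trivialization.symmL_apply (R := ℝ) _ (by exact hsrc) v).symm.trans (DFunLike.congr_fun hA v)
  rw [chartMetric_apply]
  simp only [Function.comp_apply]
  rw [inCoordinates_apply_eq₂ (by exact hsrc) (by exact hsrc) (by simp)]
  rw [hA', hA']
  simp
  rfl

end Charts

/-! ### Symmetry and bilinearity of the Christoffel symbols -/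

section Christoffel

open Filter Topology

variable {E : Type*} [NormedAddCommGroup E] [NormedSpace ℝ E]

section Bilinear

variable {G : E → E →L[ℝ] E →L[ℝ] ℝ} {u : E}

theorem directional_add_left (hG : ∀ w z, DifferentiableAt ℝ (fun t => G t w z) u)
    (v w w' z : E) : directional G u v (w + w') z = directional G u v w z + directional G u v w' z := by
  simp only [directional, map_add, add_apply]
  rw [fderiv_fun_add (hG w z) (hG w' z), add_apply]

theorem directional_smul_left (hG : ∀ w z, DifferentiableAt ℝ (fun t => G t w z) u)
    (c : ℝ) (v w z : E) : directional G u v (c • w) z = c * directional G u v w z := by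
  simp only [directional, map_smul, smul_apply]
  rw [fderiv_fun_const_smul (hG w z), smul_apply, smul_eq_mul]

variable [FiniteDimensional ℝ E]

theorem sharp_add (H : E →L[ℝ] E →L[ℝ] ℝ) (α β : E → ℝ) :
    sharp H (fun v => α v + β v) = sharp H α + sharp H β := by
  simp only [sharp, mul_add, add_smul, Finset.sum_add_distrib]

theorem sharp_smul (H : E →L[ℝ] E →L[ℝ] ℝ) (c : ℝ) (α : E → ℝ) :
    sharp H (fun v => c * α v) = c • sharp H α := by
  simp only [sharp, Finset.smul_sum, smul_smul]
  exact Finset.sum_congr rfl fun i _ => Finset.sum_congr rfl fun j _ => by ring_nf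

theorem christoffel_symm (hG : ∀ t v w, G t v w = G t w v) (v w : E) :
    christoffel G u v w = christoffel G u w v := by
  have h : ∀ z, directional G u z v w = directional G u z w v := fun z => by
    simp only [directional, hG _ v w]
  simp only [christoffel, h]
  congr 1
  ext z
  ring

/-- Two of the three terms of the defining formula contain v as an argument of the differentiated
form, which is where differentiability of the coefficients enters; in the third, v is only the
direction. -/
theorem christoffel_add (hG : ∀ w z, DifferentiableAt ℝ (fun t => G t w z) u) (v v' w : E) :
    christoffel G u (v + v') w = christoffel G u v w + christoffel G u v' w := by
  simp only [christoffel, ← sharp_add]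
  congr 1
  ext z
  rw [directional_add_left hG, directional_add_left hG]
  simp only [directional, map_add]
  ring

theorem christoffel_smul (hG : ∀ w z, DifferentiableAt ℝ (fun t => G t w z) u) (c : ℝ) (v w : E) :
    christoffel G u (c • v) w = c • christoffel G u v w := by
  simp only [christoffel, ← sharp_smul]
  congr 1
  ext z
  rw [directional_smul_left hG, directional_smul_left hG]
  simp only [directional, map_smul, smul_eq_mul]
  ring

end Bilinear

end Christoffel

/-! ### Holomorphic charts and Kähler metrics -/

section Holomorphic

open Filter Topology

variable {E : Type*} [NormedAddCommGroup E] [NormedSpace ℂ E]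
  {N : Type*} [TopologicalSpace N] [ChartedSpace E N]
  {E' : Type*} [NormedAddCommGroup E'] [NormedSpace ℂ E']
  {P : Type*} [TopologicalSpace P] [ChartedSpace E' P]

theorem mulI_apply (v : E) : mulI E v = Complex.I • v := rfl

theorem mulI_mulI (v : E) : mulI E (mulI E v) = -v := by
  simp [mulI_apply, smul_smul]

/-- The real derivative of a complex differentiable map is complex linear. -/
theorem mfderiv_real_eq {f : N → P} {y : N}
    (hf : MDifferentiableAt 𝓘(ℂ, E) 𝓘(ℂ, E') f y) :
    (mfderiv 𝓘(ℝ, E) 𝓘(ℝ, E') f y : E →L[ℝ] E') =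
      (mfderiv 𝓘(ℂ, E) 𝓘(ℂ, E') f y : E →L[ℂ] E').restrictScalars ℝ := by
  have h := hf.hasMFDerivAt
  have h' : HasMFDerivAt 𝓘(ℝ, E) 𝓘(ℝ, E') f y
      ((mfderiv 𝓘(ℂ, E) 𝓘(ℂ, E') f y : E →L[ℂ] E').restrictScalars ℝ) :=
    ⟨h.1, h.2.restrictScalars ℝ⟩
  exact h'.mfderiv

theorem mfderiv_real_mulI {f : N → P} {y : N}
    (hf : MDifferentiableAt 𝓘(ℂ, E) 𝓘(ℂ, E') f y) (v : E) :
    (mfderiv 𝓘(ℝ, E) 𝓘(ℝ, E') f y : E →L[ℝ] E') (mulI E v) =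
      mulI E' ((mfderiv 𝓘(ℝ, E) 𝓘(ℝ, E') f y : E →L[ℝ] E') v) := by
  rw [mfderiv_real_eq hf]
  exact (mfderiv 𝓘(ℂ, E) 𝓘(ℂ, E') f y : E →L[ℂ] E').map_smul _ _

variable [IsManifold 𝓘(ℂ, E) ω N]

/-- Charts of a complex manifold are holomorphic. The whole target is needed, not only the centre,
because identities that use this are differentiated later. -/
theorem chartSymmDeriv_mulI (y : N) {u : E} (hu : u ∈ (extChartAt 𝓘(ℝ, E) y).target) (v : E) :
    chartSymmDeriv y u (mulI E v) = mulI E (chartSymmDeriv y u v) := by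
  have : IsManifold 𝓘(ℂ, E) 1 N := IsManifold.of_le (n := ω) le_top
  have h : MDifferentiableAt 𝓘(ℂ, E) 𝓘(ℂ, E) (extChartAt 𝓘(ℂ, E) y).symm u :=
    mdifferentiableOn_extChartAt_symm.mdifferentiableAt
      ((isOpen_extChartAt_target y).mem_nhds hu)
  exact mfderiv_real_mulI h v

theorem IsKahler.chartMetric_mulI {h : Metric E N} (hh : IsKahler h) (y : N) {u : E}
    (hu : u ∈ (extChartAt 𝓘(ℝ, E) y).target) (v w : E) :
    chartMetric h y u (mulI E v) (mulI E w) = chartMetric h y u v w := by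
  rw [chartMetric_apply, chartMetric_apply, chartSymmDeriv_mulI y hu, chartSymmDeriv_mulI y hu]
  exact hh.hermitian _ _ _

variable [FiniteDimensional ℂ E]

/-- In holomorphic coordinates the Christoffel symbols of a Kähler metric have no part of
type `(1,1)`. -/
theorem IsKahler.christoffel_mulI {h : Metric E N} (hh : IsKahler h) (y : N) (v w : E) :
    christoffel (chartMetric h y) (extChartAt 𝓘(ℝ, E) y y) (mulI E v) (mulI E w) =
      -christoffel (chartMetric h y) (extChartAt 𝓘(ℝ, E) y y) v w := by
  set u := extChartAt 𝓘(ℝ, E) y y with hu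
  set D := directional (chartMetric h y) u with hD
  have hnhds : ∀ᶠ t in 𝓝 u, t ∈ (extChartAt 𝓘(ℝ, E) y).target :=
    (isOpen_extChartAt_target y).mem_nhds (mem_extChartAt_target y)
  have hsymm : ∀ a b c, D a b c = D a c b := fun a b c => by
    simp only [hD, directional, chartMetric_symm h y _ b c]
  have hinv : ∀ a b c, D a (mulI E b) (mulI E c) = D a b c := fun a b c => by
    have : (fun t => chartMetric h y t (mulI E b) (mulI E c)) =ᶠ[𝓝 u]
        fun t => chartMetric h y t b c := by
      filter_upwards [hnhds] with t ht using hh.chartMetric_mulI y ht b c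
    simp only [hD, directional]
    rw [this.fderiv_eq]
  have hneg : ∀ a b c, D a (-b) c = -D a b c := fun a b c => by
    simp only [hD, directional, map_neg, neg_apply]
    rw [fderiv_fun_neg, neg_apply]
  have hclosed : ∀ a b c, D a (mulI E b) c + D b (mulI E c) a + D c (mulI E a) b = 0 :=
    fun a b c => hh.closed y a b c
  -- This is dω(a, Jb, c) = 0, with J moved between the slots by Hermitian invariance. The sum of
  -- this identity for (v, w, z) and (w, v, z) gives `key`.
  have hmix : ∀ a b c, D a b c + D (mulI E b) (mulI E a) c = D c a b := fun a b c => by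
    have h1 := hclosed a (mulI E b) c
    have h2 := hinv (mulI E b) (mulI E c) a
    rw [mulI_mulI, hneg, hsymm _ c] at h2
    rw [mulI_mulI, hneg, hinv, ← h2] at h1
    linarith
  have key : ∀ z, D (mulI E v) (mulI E w) z + D (mulI E w) (mulI E v) z -
      D z (mulI E v) (mulI E w) = -(D v w z + D w v z - D z v w) := fun z => by
    rw [hinv]
    linarith [hmix v w z, hmix w v z, hsymm z v w]
  simp only [christoffel]
  rw [← hD]
  simp only [key]
  rw [← neg_one_smul ℝ, ← sharp_smul]
  congr 1
  ext z
  ring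

end Holomorphic

/-! ### Composition laws for second fundamental forms and tension fields -/

section Composition

open Filter Topology

variable {E : Type*} [NormedAddCommGroup E] [NormedSpace ℝ E]
  {M : Type*} [TopologicalSpace M] [ChartedSpace E M]
  {E' : Type*} [NormedAddCommGroup E'] [NormedSpace ℝ E']
  {N : Type*} [TopologicalSpace N] [ChartedSpace E' N]
  {E'' : Type*} [NormedAddCommGroup E''] [NormedSpace ℝ E'']
  {P : Type*} [TopologicalSpace P] [ChartedSpace E'' P]

variable (E E') in
/-- The map `φ` in the preferred charts at `x` and `φ x`. -/
abbrev inCharts (φ : M → N) (x : M) : E → E' := writtenInExtChartAt 𝓘(ℝ, E) 𝓘(ℝ, E') x φ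

variable (E E') in
/-- The derivative of `φ` in the preferred charts. -/
def chartDeriv (φ : M → N) (x : M) : E →L[ℝ] E' :=
  fderiv ℝ (inCharts E E' φ x) (extChartAt 𝓘(ℝ, E) x x)

theorem inCharts_center (φ : M → N) (x : M) :
    inCharts E E' φ x (extChartAt 𝓘(ℝ, E) x x) = extChartAt 𝓘(ℝ, E') (φ x) (φ x) := by
  simp [inCharts, writtenInExtChartAt]

theorem contDiffAt_inCharts {φ : M → N} {x : M} (hφ : ContMDiffAt 𝓘(ℝ, E) 𝓘(ℝ, E') ∞ φ x) :
    ContDiffAt ℝ ∞ (inCharts E E' φ x) (extChartAt 𝓘(ℝ, E) x x) := by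
  have h := (contMDiffAt_iff.1 hφ).2
  rw [modelWithCornersSelf_coe, Set.range_id, contDiffWithinAt_univ] at h
  exact h

theorem mfderiv_eq_chartDeriv {φ : M → N} {x : M}
    (hφ : MDifferentiableAt 𝓘(ℝ, E) 𝓘(ℝ, E') φ x) :
    (mfderiv 𝓘(ℝ, E) 𝓘(ℝ, E') φ x : E →L[ℝ] E') = chartDeriv E E' φ x := by
  have h := hφ.mfderiv
  rw [modelWithCornersSelf_coe, Set.range_id, fderivWithin_univ] at h
  exact h

theorem inCharts_comp {φ : M → N} {ψ : N → P} {x : M} (hφ : ContinuousAt φ x) :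
    inCharts E E'' (ψ ∘ φ) x =ᶠ[𝓝 (extChartAt 𝓘(ℝ, E) x x)]
      inCharts E' E'' ψ (φ x) ∘ inCharts E E' φ x := by
  have h := writtenInExtChartAt_comp (I := 𝓘(ℝ, E)) (I' := 𝓘(ℝ, E')) (I'' := 𝓘(ℝ, E''))
    (g := ψ) hφ.continuousWithinAt (s := Set.univ)
  rw [Set.preimage_univ, Set.univ_inter, modelWithCornersSelf_coe, Set.range_id,
    nhdsWithin_univ] at h
  exact h

/-- The chain rule for second derivatives. -/
theorem fderiv_fderiv_comp {F : E' → E''} {f : E → E'} {u : E} (hF : ContDiffAt ℝ ∞ F (f u))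
    (hf : ContDiffAt ℝ ∞ f u) (v w : E) :
    fderiv ℝ (fderiv ℝ (F ∘ f)) u v w =
      fderiv ℝ (fderiv ℝ F) (f u) (fderiv ℝ f u v) (fderiv ℝ f u w)
        + fderiv ℝ F (f u) (fderiv ℝ (fderiv ℝ f) u v w) := by
  have hF1 : ∀ᶠ t in 𝓝 u, DifferentiableAt ℝ F (f t) :=
    hf.continuousAt.eventually
      (((hF.of_le (m := 1) (by simp)).eventually (by simp)).mono fun t ht => ht.differentiableAt one_ne_zero)
  have hf1 : ∀ᶠ t in 𝓝 u, DifferentiableAt ℝ f t :=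
    ((hf.of_le (m := 1) (by simp)).eventually (by simp)).mono fun t ht => ht.differentiableAt one_ne_zero
  have h1 : fderiv ℝ (F ∘ f) =ᶠ[𝓝 u] fun t => (fderiv ℝ F (f t)).comp (fderiv ℝ f t) := by
    filter_upwards [hF1, hf1] with t h1 h2 using fderiv_comp t h1 h2
  have hF2 : DifferentiableAt ℝ (fderiv ℝ F) (f u) :=
    (hF.fderiv_right (m := 1) (by norm_cast)).differentiableAt (by simp)
  have hf2 : DifferentiableAt ℝ (fderiv ℝ f) u :=
    (hf.fderiv_right (m := 1) (by norm_cast)).differentiableAt (by simp)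
  have hfd : DifferentiableAt ℝ f u := hf.differentiableAt (by simp)
  have h2 : fderiv ℝ (fun t => fderiv ℝ F (f t)) u =
      (fderiv ℝ (fderiv ℝ F) (f u)).comp (fderiv ℝ f u) := fderiv_comp u hF2 hfd
  rw [h1.fderiv_eq, fderiv_clm_comp (show DifferentiableAt ℝ (fun t => fderiv ℝ F (f t)) u from
    hF2.comp u hfd) hf2, h2]
  simp [add_comm]

theorem chartDeriv_comp {φ : M → N} {ψ : N → P} {x : M}
    (hφ : ContMDiffAt 𝓘(ℝ, E) 𝓘(ℝ, E') ∞ φ x) (hψ : ContMDiffAt 𝓘(ℝ, E') 𝓘(ℝ, E'') ∞ ψ (φ x)) :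
    chartDeriv E E'' (ψ ∘ φ) x =
      (chartDeriv E' E'' ψ (φ x)).comp (chartDeriv E E' φ x) := by
  unfold chartDeriv
  rw [(inCharts_comp (E' := E') hφ.continuousAt).fderiv_eq, fderiv_comp, inCharts_center]
  · rw [inCharts_center]
    exact (contDiffAt_inCharts hψ).differentiableAt (by simp)
  · exact (contDiffAt_inCharts hφ).differentiableAt (by simp)

variable [FiniteDimensional ℝ E] [FiniteDimensional ℝ E'] [FiniteDimensional ℝ E'']
  [IsManifold 𝓘(ℝ, E) ∞ M] [IsManifold 𝓘(ℝ, E') ∞ N] [IsManifold 𝓘(ℝ, E'') ∞ P]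

theorem secondFundamentalForm_eq (g : Metric E M) (h : Metric E' N) (φ : M → N) (x : M) (v w : E) :
    secondFundamentalForm g h φ x v w =
      fderiv ℝ (fderiv ℝ (inCharts E E' φ x)) (extChartAt 𝓘(ℝ, E) x x) v w
        - chartDeriv E E' φ x (christoffel (chartMetric g x) (extChartAt 𝓘(ℝ, E) x x) v w)
        + christoffel (chartMetric h (φ x)) (extChartAt 𝓘(ℝ, E') (φ x) (φ x))
          (chartDeriv E E' φ x v) (chartDeriv E E' φ x w) := by
  rw [← inCharts_center (E := E) φ x]
  rfl

/-- The composition law for second fundamental forms. -/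
theorem secondFundamentalForm_comp (g : Metric E M) (h : Metric E' N) (k : Metric E'' P)
    {φ : M → N} {ψ : N → P} {x : M}
    (hφ : ContMDiffAt 𝓘(ℝ, E) 𝓘(ℝ, E') ∞ φ x) (hψ : ContMDiffAt 𝓘(ℝ, E') 𝓘(ℝ, E'') ∞ ψ (φ x))
    (v w : E) :
    secondFundamentalForm g k (ψ ∘ φ) x v w =
      chartDeriv E' E'' ψ (φ x) (secondFundamentalForm g h φ x v w)
      + secondFundamentalForm h k ψ (φ x) (chartDeriv E E' φ x v) (chartDeriv E E' φ x w) := by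
  have hF : ContDiffAt ℝ ∞ (inCharts E' E'' ψ (φ x))
      (inCharts E E' φ x (extChartAt 𝓘(ℝ, E) x x)) := by
    rw [inCharts_center]
    exact contDiffAt_inCharts hψ
  have h2 := fderiv_fderiv_comp hF (contDiffAt_inCharts hφ) v w
  rw [secondFundamentalForm_eq, secondFundamentalForm_eq, secondFundamentalForm_eq,
    chartDeriv_comp hφ hψ, (inCharts_comp (E' := E') hφ.continuousAt).fderiv.fderiv_eq, h2, inCharts_center]
  -- The Christoffel term of N occurs twice with opposite signs, once under dψ and once in ∇dψ, and
  -- cancels.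
  simp only [map_add, map_sub, ContinuousLinearMap.comp_apply]
  unfold chartDeriv
  simp only [Function.comp_apply]
  abel

theorem secondFundamentalForm_add_left (g : Metric E M) (h : Metric E' N) (φ : M → N) (x : M)
    (v v' w : E) : secondFundamentalForm g h φ x (v + v') w =
      secondFundamentalForm g h φ x v w + secondFundamentalForm g h φ x v' w := by
  simp only [secondFundamentalForm_eq, map_add, add_apply,
    christoffel_add (differentiableAt_chartMetric g x),
    christoffel_add (differentiableAt_chartMetric h (φ x))]
  abel

theorem secondFundamentalForm_smul_left (g : Metric E M) (h : Metric E' N) (φ : M → N) (x : M)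
    (c : ℝ) (v w : E) : secondFundamentalForm g h φ x (c • v) w =
      c • secondFundamentalForm g h φ x v w := by
  simp only [secondFundamentalForm_eq, map_smul, smul_apply,
    christoffel_smul (differentiableAt_chartMetric g x),
    christoffel_smul (differentiableAt_chartMetric h (φ x)), smul_add, smul_sub]

theorem secondFundamentalForm_symm (g : Metric E M) (h : Metric E' N) {φ : M → N} {x : M}
    (hφ : ContMDiffAt 𝓘(ℝ, E) 𝓘(ℝ, E') ∞ φ x) (v w : E) :
    secondFundamentalForm g h φ x v w = secondFundamentalForm g h φ x w v := by
  have hs : IsSymmSndFDerivAt ℝ (inCharts E E' φ x) (extChartAt 𝓘(ℝ, E) x x) :=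
    (contDiffAt_inCharts hφ).isSymmSndFDerivAt (by
      simpa using WithTop.coe_le_coe.2 (le_top : (2 : ℕ∞) ≤ ⊤))
  rw [secondFundamentalForm_eq, secondFundamentalForm_eq, hs.eq,
    christoffel_symm (chartMetric_symm g x), christoffel_symm (chartMetric_symm h (φ x))]

/-- The second fundamental form of a smooth map, bundled as a bilinear map. -/
def secondFundamentalFormₗ (g : Metric E M) (h : Metric E' N) {φ : M → N} {x : M}
    (hφ : ContMDiffAt 𝓘(ℝ, E) 𝓘(ℝ, E') ∞ φ x) : E →ₗ[ℝ] E →ₗ[ℝ] E' :=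
  LinearMap.mk₂ ℝ (secondFundamentalForm g h φ x)
    (secondFundamentalForm_add_left g h φ x)
    (secondFundamentalForm_smul_left g h φ x)
    (fun v w w' => by
      simp only [secondFundamentalForm_symm g h hφ v, secondFundamentalForm_add_left])
    (fun c v w => by
      simp only [secondFundamentalForm_symm g h hφ v, secondFundamentalForm_smul_left])

/-- The tension field at a point, as a vector of the model space. -/
def modelTension (g : Metric E M) (h : Metric E' N) (φ : M → N) (x : M) : E' :=
  traceWith (innerModel g x) (secondFundamentalForm g h φ x)

/-- The two traces agree because the chart metric at the centre is the metric at the point. -/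
theorem tensionField_eq_zero_iff {g : Metric E M} {h : Metric E' N} {φ : M → N} {x : M} :
    tensionField g h φ x = 0 ↔ modelTension g h φ x = 0 := by
  rw [modelTension, ← chartMetric_center]
  rfl

/-- The composition law for tension fields. -/
theorem modelTension_comp (g : Metric E M) (h : Metric E' N) (k : Metric E'' P)
    {φ : M → N} {ψ : N → P} {x : M}
    (hφ : ContMDiffAt 𝓘(ℝ, E) 𝓘(ℝ, E') ∞ φ x) (hψ : ContMDiffAt 𝓘(ℝ, E') 𝓘(ℝ, E'') ∞ ψ (φ x)) :
    modelTension g k (ψ ∘ φ) x =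
      chartDeriv E' E'' ψ (φ x) (modelTension g h φ x)
      + traceWith (innerModel g x) (fun v w =>
        secondFundamentalForm h k ψ (φ x) (chartDeriv E E' φ x v) (chartDeriv E E' φ x w)) := by
  have h3 : secondFundamentalForm g k (ψ ∘ φ) x = fun v w =>
      chartDeriv E' E'' ψ (φ x) (secondFundamentalForm g h φ x v w)
      + secondFundamentalForm h k ψ (φ x) (chartDeriv E E' φ x v) (chartDeriv E E' φ x w) := by
    ext v w
    exact secondFundamentalForm_comp g h k hφ hψ v w
  have h4 := map_traceWith (innerModel g x)
    (chartDeriv E' E'' ψ (φ x) : E' →ₗ[ℝ] E'') (secondFundamentalForm g h φ x)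
  rw [modelTension, h3, traceWith_add]
  exact congrArg (· + _) h4.symm

end Composition

/-! ### Linearity of the adjoint -/

section Adjoint

variable {V : Type*} [AddCommGroup V] [Module ℝ V] [TopologicalSpace V] [FiniteDimensional ℝ V]
  {W : Type*} [AddCommGroup W] [Module ℝ W] [TopologicalSpace W] [FiniteDimensional ℝ W]

/-- The adjoint with respect to a scalar product, as a linear map. -/
def adjointₗ (G : V →L[ℝ] V →L[ℝ] ℝ) (hG : ∀ v w, G v w = G w v)
    (hGpos : ∀ v, v ≠ 0 → 0 < G v v) (H : W →L[ℝ] W →L[ℝ] ℝ) (A : V →L[ℝ] W) : W →ₗ[ℝ] V where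
  toFun := adjointWith G H A
  map_add' w w' := eq_of_forall_form_eq G hGpos fun v => by
    rw [map_add G, add_apply]
    simp only [adjointWith_spec G H A hG hGpos, map_add, add_apply]
  map_smul' c w := eq_of_forall_form_eq G hGpos fun v => by
    rw [map_smul G, smul_apply]
    simp only [adjointWith_spec G H A hG hGpos, map_smul, smul_apply, RingHom.id_apply]

end Adjoint

/-! ### Composition with (anti)holomorphic maps -/

section Forward

open Filter Topology

variable {F : Type*} [NormedAddCommGroup F] [NormedSpace ℝ F]
  {M : Type*} [TopologicalSpace M] [ChartedSpace F M]
  {E : Type*} [NormedAddCommGroup E] [NormedSpace ℂ E]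
  {N : Type*} [TopologicalSpace N] [ChartedSpace E N]
  {E' : Type*} [NormedAddCommGroup E'] [NormedSpace ℂ E']
  {P : Type*} [TopologicalSpace P] [ChartedSpace E' P]

/-- `ψ` is smooth on `U` with `dψ ∘ J = ε J ∘ dψ`; for `ε = 1` it is holomorphic, for `ε = -1`
antiholomorphic. -/
structure IsSignHolomorphicOn (ε : ℝ) (ψ : N → P) (U : Set N) : Prop where
  contMDiffOn : ContMDiffOn 𝓘(ℝ, E) 𝓘(ℝ, E') ∞ ψ U
  mfderiv_mulI : ∀ y ∈ U, ∀ v : E,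
    (mfderiv 𝓘(ℝ, E) 𝓘(ℝ, E') ψ y : E →L[ℝ] E') (mulI E v) =
      ε • mulI E' ((mfderiv 𝓘(ℝ, E) 𝓘(ℝ, E') ψ y : E →L[ℝ] E') v)

/-- Treats both cases at once: the later arguments use only ε² = 1. -/
theorem exists_isSignHolomorphicOn {ψ : N → P} {U : Set N}
    (h : IsHolomorphicOn (E := E) (E' := E') ψ U ∨ IsAntiholomorphicOn (E := E) (E' := E') ψ U) :
    ∃ ε : ℝ, ε * ε = 1 ∧ IsSignHolomorphicOn (E := E) (E' := E') ε ψ U := by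
  rcases h with h | h
  · refine ⟨1, by norm_num, h.1, fun y hy v => ?_⟩
    rw [one_smul]
    exact h.2 y hy v
  · refine ⟨-1, by norm_num, h.1, fun y hy v => ?_⟩
    rw [neg_one_smul]
    exact h.2 y hy v

variable [IsManifold 𝓘(ℂ, E) ω N] [IsManifold 𝓘(ℂ, E') ω P]

/-- The differential in charts of an (anti)holomorphic map is complex (anti)linear near the
centre of the chart. -/
theorem IsSignHolomorphicOn.fderiv_inCharts_mulI {ε : ℝ} {ψ : N → P} {U : Set N}
    (h : IsSignHolomorphicOn (E := E) (E' := E') ε ψ U) (hU : IsOpen U) {y : N} (hy : y ∈ U) :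
    ∀ᶠ u in 𝓝 (extChartAt 𝓘(ℝ, E) y y), ∀ v,
      fderiv ℝ (inCharts E E' ψ y) u (mulI E v) =
        ε • mulI E' (fderiv ℝ (inCharts E E' ψ y) u v) := by
  have : IsManifold 𝓘(ℂ, E') 1 P := IsManifold.of_le (n := ω) le_top
  have : IsManifold 𝓘(ℝ, E) 1 N := IsManifold.of_le (n := ω) le_top
  have : IsManifold 𝓘(ℝ, E') 1 P := IsManifold.of_le (n := ω) le_top
  have hcont : ContinuousAt ψ y := (h.contMDiffOn.contMDiffAt (hU.mem_nhds hy)).continuousAt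
  have hmem : ∀ᶠ z in 𝓝 y, z ∈ U ∧ ψ z ∈ (chartAt E' (ψ y)).source :=
    (hU.eventually_mem hy).and
      (hcont.eventually ((chartAt E' (ψ y)).open_source.mem_nhds (mem_chart_source E' (ψ y))))
  have hmem' : ∀ᶠ u in 𝓝 (extChartAt 𝓘(ℝ, E) y y), (extChartAt 𝓘(ℝ, E) y).symm u ∈ U ∧
      ψ ((extChartAt 𝓘(ℝ, E) y).symm u) ∈ (chartAt E' (ψ y)).source := by
    have hc := continuousAt_extChartAt_symm (I := 𝓘(ℝ, E)) y
    rw [ContinuousAt, extChartAt_to_inv] at hc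
    exact hc.eventually hmem
  filter_upwards [hmem', (isOpen_extChartAt_target (I := 𝓘(ℝ, E)) y).mem_nhds
    (mem_extChartAt_target y)] with u ⟨hu1, hu2⟩ hu v
  have hC : MDifferentiableAt 𝓘(ℝ, E) 𝓘(ℝ, E) (extChartAt 𝓘(ℝ, E) y).symm u :=
    mdifferentiableOn_extChartAt_symm.mdifferentiableAt
      ((isOpen_extChartAt_target y).mem_nhds hu)
  have hB : MDifferentiableAt 𝓘(ℝ, E) 𝓘(ℝ, E') ψ ((extChartAt 𝓘(ℝ, E) y).symm u) :=
    (h.contMDiffOn.contMDiffAt (hU.mem_nhds hu1)).mdifferentiableAt (by simp)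
  have hA : MDifferentiableAt 𝓘(ℝ, E') 𝓘(ℝ, E') (extChartAt 𝓘(ℝ, E') (ψ y))
      (ψ ((extChartAt 𝓘(ℝ, E) y).symm u)) := mdifferentiableAt_extChartAt hu2
  have hA' : MDifferentiableAt 𝓘(ℂ, E') 𝓘(ℂ, E') (extChartAt 𝓘(ℂ, E') (ψ y))
      (ψ ((extChartAt 𝓘(ℝ, E) y).symm u)) := mdifferentiableAt_extChartAt hu2
  -- In charts ψ is chart ∘ ψ ∘ inverse chart; the outer factors have complex linear derivatives, so
  -- the sign ε comes from ψ alone.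
  have hcomp := (hA.hasMFDerivAt.comp u (hB.hasMFDerivAt.comp u hC.hasMFDerivAt)).mfderiv
  rw [mfderiv_eq_fderiv] at hcomp
  set A : E' →L[ℝ] E' := mfderiv 𝓘(ℝ, E') 𝓘(ℝ, E') (extChartAt 𝓘(ℂ, E') (ψ y))
    (ψ ((extChartAt 𝓘(ℝ, E) y).symm u))
  set B : E →L[ℝ] E' := mfderiv 𝓘(ℝ, E) 𝓘(ℝ, E') ψ ((extChartAt 𝓘(ℝ, E) y).symm u)
  have key : ∀ v, fderiv ℝ (inCharts E E' ψ y) u v = A (B (chartSymmDeriv y u v)) :=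
    fun v => DFunLike.congr_fun hcomp v
  have hAJ : ∀ v, A (mulI E' v) = mulI E' (A v) := mfderiv_real_mulI hA'
  have hBJ : ∀ v, B (mulI E v) = ε • mulI E' (B v) := h.mfderiv_mulI _ hu1
  rw [key, key, chartSymmDeriv_mulI y hu, hBJ, map_smul, hAJ]

theorem IsSignHolomorphicOn.chartDeriv_mulI {ε : ℝ} {ψ : N → P} {U : Set N}
    (h : IsSignHolomorphicOn (E := E) (E' := E') ε ψ U) (hU : IsOpen U) {y : N} (hy : y ∈ U)
    (v : E) : chartDeriv E E' ψ y (mulI E v) = ε • mulI E' (chartDeriv E E' ψ y v) :=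
  (h.fderiv_inCharts_mulI hU hy).self_of_nhds v

variable [FiniteDimensional ℝ F] [IsManifold 𝓘(ℝ, F) ∞ M]

/-- The adjoint of `dφ`, on the model spaces. -/
def adjointDeriv (g : Metric F M) (h : Metric E N) (φ : M → N) (x : M) : E →ₗ[ℝ] F :=
  adjointₗ (innerModel g x) (innerModel_symm g x) (innerModel_pos g x) (innerModel h (φ x))
    (chartDeriv F E φ x)

theorem adjointDeriv_spec (g : Metric F M) (h : Metric E N) (φ : M → N) (x : M) (w : E) (v : F) :
    innerModel g x (adjointDeriv g h φ x w) v = innerModel h (φ x) w (chartDeriv F E φ x v) :=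
  adjointWith_spec _ _ _ (innerModel_symm g x) (innerModel_pos g x) _ _

/-- Differentiability is what identifies `mfderiv` with the derivative in charts; otherwise
`mfderiv` is zero by convention. -/
theorem isPHWCOn_iff (g : Metric F M) (h : Metric E N) {φ : M → N} {s : Set M}
    (hφ : ∀ x ∈ s, MDifferentiableAt 𝓘(ℝ, F) 𝓘(ℝ, E) φ x) :
    IsPHWCOn g h φ s ↔ ∀ x ∈ s, ∀ w : E,
      chartDeriv F E φ x (adjointDeriv g h φ x (mulI E w)) =
        mulI E (chartDeriv F E φ x (adjointDeriv g h φ x w)) := by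
  refine forall₂_congr fun x hx => forall_congr' fun w => ?_
  unfold adjointDeriv
  rw [← mfderiv_eq_chartDeriv (hφ x hx)]
  rfl

theorem innerModel_mulI {h : Metric E N} (hh : IsKahler h) (y : N) (v w : E) :
    innerModel h y (mulI E v) (mulI E w) = innerModel h y v w :=
  hh.hermitian y v w

/-- An isometry with square -1 is skew. -/
theorem innerModel_mulI_left {h : Metric E N} (hh : IsKahler h) (y : N) (v w : E) :
    innerModel h y (mulI E v) w = -innerModel h y v (mulI E w) := by
  rw [← innerModel_mulI hh y v (mulI E w), mulI_mulI, map_neg, neg_neg]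

variable [FiniteDimensional ℂ E]

/-- Trace of the pull-back of an anti-invariant form under a pseudo horizontally weakly conformal
map. -/
theorem traceWith_chartDeriv_eq_zero {g : Metric F M} {h : Metric E N} (hh : IsKahler h)
    {φ : M → N} {x : M} (hφ : ∀ w : E,
      chartDeriv F E φ x (adjointDeriv g h φ x (mulI E w)) =
        mulI E (chartDeriv F E φ x (adjointDeriv g h φ x w)))
    (B : E →ₗ[ℝ] E →ₗ[ℝ] E') (hB : ∀ v w, B (mulI E v) (mulI E w) = -B v w) :
    traceWith (innerModel g x) (fun v w => B (chartDeriv F E φ x v) (chartDeriv F E φ x w)) = 0 :=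
  traceWith_pullback_eq_zero (innerModel g x) (innerModel_symm g x) (innerModel_pos g x)
    (innerModel h (φ x)) (innerModel_symm h (φ x)) (innerModel_pos h (φ x))
    (chartDeriv F E φ x : F →ₗ[ℝ] E) (adjointDeriv g h φ x) (adjointDeriv_spec g h φ x)
    (mulI E : E →ₗ[ℝ] E) mulI_mulI (innerModel_mulI hh (φ x)) hφ B hB

/-- Pseudo horizontal weak conformality is preserved by composition with (anti)holomorphic
maps. -/
theorem IsSignHolomorphicOn.phwc_comp {ε : ℝ} (hε : ε * ε = 1) {ψ : N → P}
    {U : Set N} (hψ : IsSignHolomorphicOn (E := E) (E' := E') ε ψ U) (hU : IsOpen U)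
    {g : Metric F M} {h : Metric E N} (hh : IsKahler h) {k : Metric E' P} (hk : IsKahler k)
    {φ : M → N} {x : M} (hx : φ x ∈ U) (hφ : ContMDiffAt 𝓘(ℝ, F) 𝓘(ℝ, E) ∞ φ x)
    (hφ' : ∀ w : E, chartDeriv F E φ x (adjointDeriv g h φ x (mulI E w)) =
      mulI E (chartDeriv F E φ x (adjointDeriv g h φ x w))) (w : E') :
    chartDeriv F E' (ψ ∘ φ) x (adjointDeriv g k (ψ ∘ φ) x (mulI E' w)) =
      mulI E' (chartDeriv F E' (ψ ∘ φ) x (adjointDeriv g k (ψ ∘ φ) x w)) := by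
  have hD := chartDeriv_comp hφ (hψ.contMDiffOn.contMDiffAt (hU.mem_nhds hx))
  have hT : ∀ w : E', adjointDeriv g k (ψ ∘ φ) x w =
      adjointDeriv g h φ x (adjointDeriv h k ψ (φ x) w) := fun w =>
    eq_of_forall_form_eq (innerModel g x) (innerModel_pos g x) fun v => by
      rw [adjointDeriv_spec, adjointDeriv_spec, adjointDeriv_spec, hD]
      rfl
  -- The adjoint inherits the rule dψ J = ε J dψ: J is skew on both sides, so the two minus signs
  -- cancel.
  have hS : ∀ w : E', adjointDeriv h k ψ (φ x) (mulI E' w) =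
      ε • mulI E (adjointDeriv h k ψ (φ x) w) := fun w =>
    eq_of_forall_form_eq (innerModel h (φ x)) (innerModel_pos h (φ x)) fun v => by
      rw [adjointDeriv_spec, innerModel_mulI_left hk, map_smul, smul_apply,
        innerModel_mulI_left hh, adjointDeriv_spec, hψ.chartDeriv_mulI hU hx, map_smul, smul_neg,
        smul_eq_mul, smul_eq_mul, ← mul_assoc, hε, one_mul]
  rw [hT, hT, hS, hD, map_smul, map_smul]
  simp only [ContinuousLinearMap.comp_apply]
  rw [hφ', hψ.chartDeriv_mulI hU hx, smul_smul, hε,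
    one_smul]

variable [FiniteDimensional ℂ E']

/-- The second fundamental form of an (anti)holomorphic map between Kähler manifolds has no part
of type `(1,1)`. -/
theorem IsSignHolomorphicOn.secondFundamentalForm_mulI {ε : ℝ} (hε : ε * ε = 1) {ψ : N → P}
    {U : Set N} (h : IsSignHolomorphicOn (E := E) (E' := E') ε ψ U) (hU : IsOpen U) {y : N}
    (hy : y ∈ U) {g : Metric E N} (hg : IsKahler g) {k : Metric E' P} (hk : IsKahler k) (v w : E) :
    secondFundamentalForm g k ψ y (mulI E v) (mulI E w) = -secondFundamentalForm g k ψ y v w := by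
  have hψ : ContMDiffAt 𝓘(ℝ, E) 𝓘(ℝ, E') ∞ ψ y := h.contMDiffOn.contMDiffAt (hU.mem_nhds hy)
  set f := inCharts E E' ψ y
  set u := extChartAt 𝓘(ℝ, E) y y with hu
  have hs : IsSymmSndFDerivAt ℝ f u := (contDiffAt_inCharts hψ).isSymmSndFDerivAt (by
    simpa using WithTop.coe_le_coe.2 (le_top : (2 : ℕ∞) ≤ ⊤))
  have hd : DifferentiableAt ℝ (fderiv ℝ f) u :=
    ((contDiffAt_inCharts hψ).fderiv_right (m := 1) (by norm_cast)).differentiableAt (by simp)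
  -- Differentiate Df(Jb) = ε J Df(b), valid near u, in the direction a. Symmetry of D²f then gives
  -- the same rule in the first slot, and ε²J² = -1.
  have h2 : ∀ a b, fderiv ℝ (fderiv ℝ f) u a (mulI E b) =
      ε • mulI E' (fderiv ℝ (fderiv ℝ f) u a b) := fun a b => by
    have h3 : (fun t => fderiv ℝ f t (mulI E b)) =ᶠ[𝓝 u]
        fun t => (ε • mulI E') (fderiv ℝ f t b) :=
      (h.fderiv_inCharts_mulI hU hy).mono fun t ht => ht b
    have h4 : HasFDerivAt (fun t => fderiv ℝ f t (mulI E b))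
        ((fderiv ℝ (fderiv ℝ f) u).flip (mulI E b)) u := by
      simpa using hd.hasFDerivAt.clm_apply (hasFDerivAt_const (mulI E b) u)
    have h5 : HasFDerivAt (fun t => fderiv ℝ f t b)
        ((fderiv ℝ (fderiv ℝ f) u).flip b) u := by
      simpa using hd.hasFDerivAt.clm_apply (hasFDerivAt_const b u)
    have h6 : HasFDerivAt (fun t => (ε • mulI E') (fderiv ℝ f t b))
        ((ε • mulI E').comp ((fderiv ℝ (fderiv ℝ f) u).flip b)) u :=
      (ε • mulI E').hasFDerivAt.comp u h5
    exact DFunLike.congr_fun (h4.unique (h6.congr_of_eventuallyEq h3)) a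
  have h1 : fderiv ℝ (fderiv ℝ f) u (mulI E v) (mulI E w) = -fderiv ℝ (fderiv ℝ f) u v w := by
    rw [h2, hs.eq, h2, hs.eq, map_smul, smul_smul, hε, one_smul, mulI_mulI]
  have hΓ : ∀ a b : E', christoffel (chartMetric k (ψ y)) (extChartAt 𝓘(ℝ, E') (ψ y) (ψ y))
      (ε • a) (ε • b) = christoffel (chartMetric k (ψ y)) (extChartAt 𝓘(ℝ, E') (ψ y) (ψ y)) a b :=
    fun a b => by
      rw [christoffel_smul (differentiableAt_chartMetric k (ψ y)),
        christoffel_symm (chartMetric_symm k (ψ y)),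
        christoffel_smul (differentiableAt_chartMetric k (ψ y)), smul_smul, hε, one_smul,
        christoffel_symm (chartMetric_symm k (ψ y))]
  rw [secondFundamentalForm_eq, secondFundamentalForm_eq, h.chartDeriv_mulI hU hy,
    h.chartDeriv_mulI hU hy, hΓ, hk.christoffel_mulI, hg.christoffel_mulI, h1, map_neg]
  abel

end Forward

/-! ### Holomorphic test maps and the converse -/

section Backward

open Filter Topology

variable {F : Type*} [NormedAddCommGroup F] [NormedSpace ℝ F]
  {M : Type*} [TopologicalSpace M] [ChartedSpace F M]
  {E : Type*} [NormedAddCommGroup E] [NormedSpace ℂ E]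
  {N : Type*} [TopologicalSpace N] [ChartedSpace E N]
  {E' : Type*} [NormedAddCommGroup E'] [NormedSpace ℂ E']
  {P : Type*} [TopologicalSpace P] [ChartedSpace E' P]

/-- In the applications u₀ and c are the chart centres in N and P, so that the model carries centre
to centre. -/
theorem fderiv_linear_model (l : E →L[ℂ] ℂ) (c e : E') (u₀ u v : E) :
    fderiv ℝ (fun u => c + l (u - u₀) • e) u v = l v • e := by
  have h1 : HasFDerivAt (fun u => l (u - u₀)) (l.restrictScalars ℝ) u :=
    (l.restrictScalars ℝ).hasFDerivAt.comp u (hasFDerivAt_sub_const u₀)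
  rw [((h1.smul_const e).const_add c).fderiv]
  rfl

theorem fderiv_quadratic_model (l : E →L[ℂ] ℂ) (c e : E') (u₀ u : E) :
    fderiv ℝ (fun u => c + l (u - u₀) • l (u - u₀) • e) u =
      l (u - u₀) • (2 : ℂ) • (l.restrictScalars ℝ).smulRight e := by
  have h1 : HasFDerivAt (fun u => l (u - u₀)) (l.restrictScalars ℝ) u :=
    (l.restrictScalars ℝ).hasFDerivAt.comp u (hasFDerivAt_sub_const u₀)
  have h2 : HasFDerivAt (fun u => c + l (u - u₀) • l (u - u₀) • e) _ u :=
    (h1.smul (h1.smul_const e)).const_add c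
  rw [h2.fderiv]
  ext v
  simp [smul_smul, ← add_smul]
  congr 1
  ring

theorem fderiv_fderiv_quadratic_model (l : E →L[ℂ] ℂ) (c e : E') (u₀ u v w : E) :
    fderiv ℝ (fderiv ℝ (fun u => c + l (u - u₀) • l (u - u₀) • e)) u v w =
      (2 * (l v * l w)) • e := by
  have h1 : HasFDerivAt (fun u => l (u - u₀)) (l.restrictScalars ℝ) u :=
    (l.restrictScalars ℝ).hasFDerivAt.comp u (hasFDerivAt_sub_const u₀)
  have h2 : fderiv ℝ (fun u => c + l (u - u₀) • l (u - u₀) • e) = fun u =>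
      l (u - u₀) • (2 : ℂ) • (l.restrictScalars ℝ).smulRight e :=
    funext fun u => fderiv_quadratic_model l c e u₀ u
  have h3 : HasFDerivAt (fun u => l (u - u₀) • (2 : ℂ) • (l.restrictScalars ℝ).smulRight e) _ u :=
    h1.smul_const ((2 : ℂ) • (l.restrictScalars ℝ).smulRight e)
  rw [h2, h3.fderiv]
  simp [smul_smul]
  congr 1
  ring

variable [IsManifold 𝓘(ℂ, E) ω N] [IsManifold 𝓘(ℂ, E') ω P]

/-- Holomorphic maps with a prescribed coordinate expression. -/
theorem exists_holomorphic_inCharts (y : N) (p : P) {q : E → E'} (hq : ContDiff ℂ ω q)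
    (hqy : q (extChartAt 𝓘(ℝ, E) y y) = extChartAt 𝓘(ℝ, E') p p) :
    ∃ (U : Set N) (ψ : N → P), IsOpen U ∧ y ∈ U ∧
      IsHolomorphicOn (E := E) (E' := E') ψ U ∧
      inCharts E E' ψ y =ᶠ[𝓝 (extChartAt 𝓘(ℝ, E) y y)] q := by
  have : IsManifold 𝓘(ℂ, E) 1 N := IsManifold.of_le (n := ω) le_top
  have : IsManifold 𝓘(ℂ, E') 1 P := IsManifold.of_le (n := ω) le_top
  set c := extChartAt 𝓘(ℝ, E) y with hc
  set d := extChartAt 𝓘(ℝ, E') p with hd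
  -- On U the expression q lands in the target of d, so ψ is a composition of holomorphic maps. By
  -- `hψy` below, the preferred chart at ψ y is d itself.
  let U : Set N := c.source ∩ (q ∘ c) ⁻¹' d.target
  let ψ : N → P := fun z => d.symm (q (c z))
  have hψy : ψ y = p := by
    simp only [ψ, hqy]
    exact extChartAt_to_inv p
  have hdt : IsOpen d.target := isOpen_extChartAt_target p
  have hU : IsOpen U :=
    (hq.continuous.comp_continuousOn (continuousOn_extChartAt y)).isOpen_inter_preimage
      (isOpen_extChartAt_source y) hdt
  refine ⟨U, ψ, hU, ⟨mem_extChartAt_source y, ?_⟩, ⟨?_, ?_⟩, ?_⟩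
  · simp only [Set.mem_preimage, Function.comp_apply, hqy]
    exact mem_extChartAt_target p
  · intro z hz
    have h1 : ContMDiffAt 𝓘(ℝ, E) 𝓘(ℝ, E) ∞ c z :=
      contMDiffAt_extChartAt' (by rw [← extChartAt_source 𝓘(ℝ, E)]; exact hz.1)
    have h2 : ContMDiffAt 𝓘(ℝ, E) 𝓘(ℝ, E') ∞ q (c z) :=
      ((hq.restrict_scalars ℝ).of_le le_top).contDiffAt.contMDiffAt
    have h3 : ContMDiffAt 𝓘(ℝ, E') 𝓘(ℝ, E') ∞ d.symm (q (c z)) :=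
      (contMDiffOn_extChartAt_symm p).contMDiffAt (hdt.mem_nhds hz.2)
    exact (h3.comp z (h2.comp z h1)).contMDiffWithinAt
  · intro z hz v
    have h1 : MDifferentiableAt 𝓘(ℂ, E) 𝓘(ℂ, E) (extChartAt 𝓘(ℂ, E) y) z :=
      mdifferentiableAt_extChartAt (by rw [← extChartAt_source 𝓘(ℝ, E)]; exact hz.1)
    have h2 : MDifferentiableAt 𝓘(ℂ, E) 𝓘(ℂ, E') q (extChartAt 𝓘(ℂ, E) y z) :=
      (hq.differentiable (by simp)).differentiableAt.mdifferentiableAt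
    have h3 : MDifferentiableAt 𝓘(ℂ, E') 𝓘(ℂ, E') (extChartAt 𝓘(ℂ, E') p).symm
        (q (extChartAt 𝓘(ℂ, E) y z)) :=
      mdifferentiableOn_extChartAt_symm.mdifferentiableAt
        ((isOpen_extChartAt_target p).mem_nhds hz.2)
    exact mfderiv_real_mulI (h3.comp z (h2.comp z h1)) v
  · have h1 : ∀ᶠ u in 𝓝 (c y), u ∈ c.target :=
      (isOpen_extChartAt_target y).mem_nhds (mem_extChartAt_target y)
    have h2 : ∀ᶠ u in 𝓝 (c y), q u ∈ d.target :=
      hq.continuous.continuousAt.eventually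
        (hdt.mem_nhds (by rw [hqy]; exact mem_extChartAt_target p))
    filter_upwards [h1, h2] with u hu1 hu2
    simp only [inCharts, writtenInExtChartAt, hψy, Function.comp_apply, ψ, ← hc, ← hd]
    rw [c.right_inv hu1, d.right_inv hu2]

variable [FiniteDimensional ℂ E] [FiniteDimensional ℂ E'] [FiniteDimensional ℝ F]
  [IsManifold 𝓘(ℝ, F) ∞ M]

/-- Harmonicity of the compositions with holomorphic maps given by squares of linear forms. -/
theorem traceWith_mul_self_eq_zero [Nontrivial E'] [Nonempty P] (g : Metric F M) (h : Metric E N)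
    (k : Metric E' P) {φ : M → N} (hφ : ContMDiff 𝓘(ℝ, F) 𝓘(ℝ, E) ∞ φ)
    (H : ∀ (U : Set N) (ψ : N → P), IsOpen U → IsHolomorphicOn (E := E) (E' := E') ψ U →
      IsHarmonicOn g k (ψ ∘ φ) (φ ⁻¹' U)) (x : M) (l : E →L[ℂ] ℂ) :
    traceWith (innerModel g x)
      (fun v w => l (chartDeriv F E φ x v) * l (chartDeriv F E φ x w)) = 0 := by
  obtain ⟨e, he⟩ := exists_ne (0 : E')
  obtain ⟨p⟩ := ‹Nonempty P›
  set u₀ := extChartAt 𝓘(ℝ, E) (φ x) (φ x) with hu₀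
  set c := extChartAt 𝓘(ℝ, E') p p
  obtain ⟨U, ψ, hU, hx, hψ, hq⟩ := exists_holomorphic_inCharts (φ x) p
    (q := fun u => c + l (u - u₀) • l (u - u₀) • e) (by fun_prop) (by
      rw [← hu₀, sub_self, map_zero, zero_smul, add_zero])
  rw [← hu₀] at hq
  have hψx := hψ.1.contMDiffAt (hU.mem_nhds hx)
  have hD : chartDeriv E E' ψ (φ x) = 0 := by
    unfold chartDeriv
    rw [← hu₀, hq.fderiv_eq, fderiv_quadratic_model]
    simp
  have hS : ∀ v w, secondFundamentalForm h k ψ (φ x) v w = (2 * (l v * l w)) • e := fun v w => by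
    -- As dψ = 0 at the centre, the Christoffel term of P has zero arguments and that of N is
    -- annihilated by dψ; only the second derivative of the model survives.
    have h0 : ∀ a, christoffel (chartMetric k (ψ (φ x)))
        (extChartAt 𝓘(ℝ, E') (ψ (φ x)) (ψ (φ x))) 0 a = 0 := fun a => by
      have := christoffel_smul (differentiableAt_chartMetric k (ψ (φ x))) 0 0 a
      rwa [zero_smul, zero_smul] at this
    rw [secondFundamentalForm_eq, ← hu₀, hq.fderiv.fderiv_eq, fderiv_fderiv_quadratic_model, hD]
    simp only [zero_apply, h0, sub_zero, add_zero]
  have h1 := modelTension_comp g h k hφ.contMDiffAt hψx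
  rw [tensionField_eq_zero_iff.1 ((H U ψ hU hψ).2 x hx), hD, zero_apply,
    zero_add] at h1
  simp only [hS] at h1
  have h2 := map_traceWith (innerModel g x)
    ((LinearMap.toSpanSingleton ℂ E' ((2 : ℂ) • e)).restrictScalars ℝ)
    (fun v w => l (chartDeriv F E φ x v) * l (chartDeriv F E φ x w))
  simp only [LinearMap.restrictScalars_apply, LinearMap.toSpanSingleton_apply, smul_smul,
    mul_comm _ (2 : ℂ)] at h2
  rw [← h1] at h2
  exact (mul_eq_zero.1 ((smul_eq_zero.1 h2).resolve_right he)).resolve_left two_ne_zero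

/-- Polarisation of `traceWith_mul_self_eq_zero`: the two cross terms for l + m agree by symmetry of
the trace. -/
theorem traceWith_mul_eq_zero [Nontrivial E'] [Nonempty P] (g : Metric F M) (h : Metric E N)
    (k : Metric E' P) {φ : M → N} (hφ : ContMDiff 𝓘(ℝ, F) 𝓘(ℝ, E) ∞ φ)
    (H : ∀ (U : Set N) (ψ : N → P), IsOpen U → IsHolomorphicOn (E := E) (E' := E') ψ U →
      IsHarmonicOn g k (ψ ∘ φ) (φ ⁻¹' U)) (x : M) (l m : E →L[ℂ] ℂ) :
    traceWith (innerModel g x)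
      (fun v w => l (chartDeriv F E φ x v) * m (chartDeriv F E φ x w)) = 0 := by
  have h1 := traceWith_mul_self_eq_zero g h k hφ H x
  have h2 := h1 (l + m)
  have h3 := traceWith_swap (innerModel g x) (innerModel_symm g x)
    (fun v w => l (chartDeriv F E φ x v) * m (chartDeriv F E φ x w))
  simp only [add_apply, add_mul, mul_add, traceWith_add, h1, zero_add, add_zero] at h2
  simp only [mul_comm (m _)] at h2
  rw [h3, ← two_smul ℝ] at h2
  exact (smul_eq_zero.1 h2).resolve_left two_ne_zero

/-- The vanishing of all traces of (m∘dφ)(l∘dφ) says that dφ dφ*, extended to complex linear forms,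
has no part pairing two such forms; this is commutation with J. -/
theorem chartDeriv_adjointDeriv_mulI [Nontrivial E'] [Nonempty P] (g : Metric F M) {h : Metric E N}
    (hh : IsKahler h) (k : Metric E' P) {φ : M → N} (hφ : ContMDiff 𝓘(ℝ, F) 𝓘(ℝ, E) ∞ φ)
    (H : ∀ (U : Set N) (ψ : N → P), IsOpen U → IsHolomorphicOn (E := E) (E' := E') ψ U →
      IsHarmonicOn g k (ψ ∘ φ) (φ ⁻¹' U)) (x : M) (a : E) :
    chartDeriv F E φ x (adjointDeriv g h φ x (mulI E a)) =
      mulI E (chartDeriv F E φ x (adjointDeriv g h φ x a)) := by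
  set D := chartDeriv F E φ x with hD
  set T := adjointDeriv g h φ x with hT
  have key : D (T a) + mulI E (D (T (mulI E a))) = 0 := by
    refine SeparatingDual.eq_zero_of_forall_dual_eq_zero (R := ℂ) fun m => ?_
    -- This is l(w) = h(a, w) - i h(a, Jw) = h(a, w) + i h(Ja, w). Contraction with m∘dφ therefore
    -- yields m applied to dφ dφ* a + J dφ dφ* Ja.
    let l : E →L[ℂ] ℂ := StrongDual.extendRCLike (innerModel h (φ x) a)
    have hl : ∀ w, l (D w) = innerModel g x (T a) w + Complex.I * innerModel g x (T (mulI E a)) w :=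
      fun w => by
        have h1 := innerModel_mulI_left hh (φ x) a (D w)
        rw [adjointDeriv_spec, adjointDeriv_spec, h1]
        simp [l, StrongDual.extendRCLike_apply, mulI_apply, sub_eq_add_neg, hD]
    have h0 := traceWith_mul_eq_zero g h k hφ H x m l
    have h1 : ∀ v w, m (D v) * l (D w) =
        innerModel g x (T a) w • m (D v) +
          innerModel g x (T (mulI E a)) w • (Complex.I * m (D v)) := fun v w => by
      rw [hl]
      simp only [Complex.real_smul]
      ring
    simp only [← hD, h1] at h0
    rw [traceWith_add] at h0
    have h2 := traceWith_form_smul (innerModel g x) (innerModel_symm g x) (innerModel_pos g x)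
      ((m.restrictScalars ℝ : E →ₗ[ℝ] ℂ) ∘ₗ (D : F →ₗ[ℝ] E)) (T a)
    have h3 := traceWith_form_smul (innerModel g x) (innerModel_symm g x) (innerModel_pos g x)
      ((((Complex.I • m).restrictScalars ℝ : E →L[ℝ] ℂ) : E →ₗ[ℝ] ℂ) ∘ₗ (D : F →ₗ[ℝ] E))
      (T (mulI E a))
    rw [map_add, mulI_apply, map_smul]
    exact (congrArg₂ (· + ·) h2 h3).symm.trans h0
  have h1 := congrArg (mulI E) key
  rw [map_add, mulI_mulI, map_zero] at h1
  exact (add_neg_eq_zero.1 h1).symm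

/-- Complex linear forms separate points, so it suffices to test with maps that are affine in
charts. -/
theorem modelTension_eq_zero [Nontrivial E'] [Nonempty P] (g : Metric F M) {h : Metric E N}
    (hh : IsKahler h) {k : Metric E' P} (hk : IsKahler k) {φ : M → N}
    (hφ : ContMDiff 𝓘(ℝ, F) 𝓘(ℝ, E) ∞ φ)
    (H : ∀ (U : Set N) (ψ : N → P), IsOpen U → IsHolomorphicOn (E := E) (E' := E') ψ U →
      IsHarmonicOn g k (ψ ∘ φ) (φ ⁻¹' U)) (x : M) :
    modelTension g h φ x = 0 := by
  obtain ⟨e, he⟩ := exists_ne (0 : E')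
  obtain ⟨p⟩ := ‹Nonempty P›
  refine SeparatingDual.eq_zero_of_forall_dual_eq_zero (R := ℂ) fun l => ?_
  set u₀ := extChartAt 𝓘(ℝ, E) (φ x) (φ x) with hu₀
  set c := extChartAt 𝓘(ℝ, E') p p
  obtain ⟨U, ψ, hU, hx, hψ, hq⟩ := exists_holomorphic_inCharts (φ x) p
    (q := fun u => c + l (u - u₀) • e) (by fun_prop) (by
      rw [← hu₀, sub_self, map_zero, zero_smul, add_zero])
  rw [← hu₀] at hq
  have hψx := hψ.1.contMDiffAt (hU.mem_nhds hx)
  have hD : ∀ v, chartDeriv E E' ψ (φ x) v = l v • e := fun v => by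
    unfold chartDeriv
    rw [← hu₀, hq.fderiv_eq, fderiv_linear_model]
  obtain ⟨ε, hε, hψε⟩ := exists_isSignHolomorphicOn (Or.inl hψ)
  have h1 := modelTension_comp g h k hφ.contMDiffAt hψx
  rw [tensionField_eq_zero_iff.1 ((H U ψ hU hψ).2 x hx), hD] at h1
  -- The affine model may still have ∇dψ ≠ 0 through the Christoffel symbols; its trace vanishes
  -- because φ is already known to be pseudo horizontally weakly conformal.
  have h2 := traceWith_chartDeriv_eq_zero (g := g) hh
    (chartDeriv_adjointDeriv_mulI g hh k hφ H x) (secondFundamentalFormₗ h k hψx)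
    (hψε.secondFundamentalForm_mulI hε hU hx hh hk)
  have h3 := h1.trans (congrArg (l (modelTension g h φ x) • e + ·) h2)
  exact (smul_eq_zero.1 (h3.trans (add_zero _)).symm).resolve_right he

end Backward
end PseudoHarmonic

end

/-! ### The characterisation -/

theorem mainTheorem3
    {EM : Type*} [NormedAddCommGroup EM] [NormedSpace ℝ EM] [FiniteDimensional ℝ EM]
    {M : Type*} [TopologicalSpace M] [ChartedSpace EM M] [IsManifold 𝓘(ℝ, EM) ∞ M]
    {EN : Type*} [NormedAddCommGroup EN] [NormedSpace ℂ EN] [FiniteDimensional ℂ EN]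
    {N : Type*} [TopologicalSpace N] [ChartedSpace EN N] [IsManifold 𝓘(ℂ, EN) ω N]
    {EP : Type*} [NormedAddCommGroup EP] [NormedSpace ℂ EP] [FiniteDimensional ℂ EP]
    [Nontrivial EP]
    {P : Type*} [TopologicalSpace P] [ChartedSpace EP P] [IsManifold 𝓘(ℂ, EP) ω P]
    [Nonempty P]
    (g : PseudoHarmonic.Metric EM M)
    (h : PseudoHarmonic.Metric EN N) (hh : PseudoHarmonic.IsKahler h)
    (k : PseudoHarmonic.Metric EP P) (hk : PseudoHarmonic.IsKahler k)
    (φ : M → N) (hφ : ContMDiff 𝓘(ℝ, EM) 𝓘(ℝ, EN) ∞ φ) :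
    PseudoHarmonic.IsPseudoHarmonicMorphism g h φ ↔
      ∀ (U : Set N) (ψ : N → P), IsOpen U →
        (PseudoHarmonic.IsHolomorphicOn (E := EN) (E' := EP) ψ U ∨
          PseudoHarmonic.IsAntiholomorphicOn (E := EN) (E' := EP) ψ U) →
        PseudoHarmonic.IsPseudoHarmonicMorphismOn g k (ψ ∘ φ) (φ ⁻¹' U) := by
  have hφd : ∀ x ∈ Set.univ, MDifferentiableAt 𝓘(ℝ, EM) 𝓘(ℝ, EN) φ x := fun x _ =>
    hφ.contMDiffAt.mdifferentiableAt (by simp)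
  constructor
  · rintro ⟨hharm, hphwc⟩ U ψ hU hψ
    rw [PseudoHarmonic.isPHWCOn_iff g h hφd] at hphwc
    obtain ⟨ε, hε, hψε⟩ := PseudoHarmonic.exists_isSignHolomorphicOn hψ
    have hsmooth : ContMDiffOn 𝓘(ℝ, EM) 𝓘(ℝ, EP) ∞ (ψ ∘ φ) (φ ⁻¹' U) :=
      hψε.contMDiffOn.comp hφ.contMDiffOn subset_rfl
    have hV : IsOpen (φ ⁻¹' U) := hU.preimage hφ.continuous
    refine ⟨⟨hsmooth, fun x hx => ?_⟩, ?_⟩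
    · have hψx := hψε.contMDiffOn.contMDiffAt (hU.mem_nhds hx)
      have h1 := PseudoHarmonic.modelTension_comp g h k hφ.contMDiffAt hψx
      have h2 := PseudoHarmonic.traceWith_chartDeriv_eq_zero (g := g) hh
        (hphwc x (Set.mem_univ x)) (PseudoHarmonic.secondFundamentalFormₗ h k hψx)
        (hψε.secondFundamentalForm_mulI hε hU hx hh hk)
      rw [PseudoHarmonic.tensionField_eq_zero_iff.1 (hharm.2 x (Set.mem_univ x)),
        map_zero, zero_add] at h1
      exact PseudoHarmonic.tensionField_eq_zero_iff.2 (h1.trans h2)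
    · rw [PseudoHarmonic.isPHWCOn_iff g k fun x hx =>
        (hsmooth.contMDiffAt (hV.mem_nhds hx)).mdifferentiableAt (by simp)]
      exact fun x hx => hψε.phwc_comp hε hU hh hk hx hφ.contMDiffAt (hphwc x (Set.mem_univ x))
  · intro H
    -- The converse needs only holomorphic ψ and only the harmonicity of the compositions.
    have H' : ∀ (U : Set N) (ψ : N → P), IsOpen U →
        PseudoHarmonic.IsHolomorphicOn (E := EN) (E' := EP) ψ U →
        PseudoHarmonic.IsHarmonicOn g k (ψ ∘ φ) (φ ⁻¹' U) :=
      fun U ψ hU hψ => (H U ψ hU (Or.inl hψ)).1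
    refine ⟨⟨hφ.contMDiffOn, fun x _ => PseudoHarmonic.tensionField_eq_zero_iff.2
      (PseudoHarmonic.modelTension_eq_zero g hh hk hφ H' x)⟩, ?_⟩
    rw [PseudoHarmonic.isPHWCOn_iff g h hφd]
    exact fun x _ => PseudoHarmonic.chartDeriv_adjointDeriv_mulI g hh k hφ H' x
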